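/- Let $\mathbb K\in\{\mathbb R,\mathbb C\}$, let $n\ge 0$ and $m\ge 1$ be integers, and let $J,R,Q\in\mathbb K^{n\times n}$ and $B\in\mathbb K^{n\times m}$ satisfy $J=-J^H$, $R=R^H\ge 0$ and $Q=Q^H\ge 0$ (positive semidefinite). Put \[ \mathcal E=\begin{bmatrix}0&I_n&0\\-I_n&0&0\\0&0&0\end{bmatrix},\qquad \mathcal A_0=\begin{bmatrix}0&(J-R)Q&B\\((J-R)Q)^H&QRQ&0\\B^H&0&0\end{bmatrix}\in\mathbb K^{(2n+m)\times(2n+m)} . \] Then \[ \operatorname{im}B\cap\ker RQ=\{0\}\quad\text{and}\quad\ker B=\{0\} \] if and only if the pencil $s\mathcal E-\mathcal A_0$ is regular (that is, $\det(s\mathcal E-\mathcal A_0)\in\mathbb K[s]$ is not the zero polynomial) and has Kronecker index exactly three. Here the Kronecker index of a regular pencil $sE-A$ is the size of the largest block belonging to the eigenvalue $\infty$ in its Kronecker canonical form: there are constant invertible matrices $P,T$ with \[ P(sE-A)T=\operatorname{diag}\bigl(sI_d-M,\ sN_{k_1}-I_{k_1},\dots,sN_{k_b}-I_{k_b}\bigr),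 \] where $M\in\mathbb K^{d\times d}$ and $N_k$ is the nilpotent Jordan block of size $k\ge1$, and the index is $\max_i k_i$ (and $0$ if $b=0$). -/

import Mathlib

open scoped ComplexOrder

namespace OptimalityPencil

open Matrix Polynomial

/-- `(J, R, Q, B) ∈ Σ_{n,m}`: `J = -Jᴴ`, `R = Rᴴ ≥ 0`, `Q = Qᴴ ≥ 0`, and `B` is arbitrary
(Mathlib's `PosSemidef` contains Hermitian symmetry). -/
structure IsPortHamiltonian {𝕜 : Type*} [RCLike 𝕜] {n m : ℕ}
    (J R Q : Matrix (Fin n) (Fin n) 𝕜) (_B : Matrix (Fin n) (Fin m) 𝕜) : Prop where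
  skew : J = -Jᴴ
  posSemidef_R : R.PosSemidef
  posSemidef_Q : Q.PosSemidef

/-- The `3 × 3` block matrix `ℰ = [0 I 0; -I 0 0; 0 0 0]`. -/
def optE (𝕜 : Type*) [RCLike 𝕜] (n m : ℕ) :
    Matrix ((Fin n ⊕ Fin n) ⊕ Fin m) ((Fin n ⊕ Fin n) ⊕ Fin m) 𝕜 :=
  fromBlocks (fromBlocks 0 1 (-1) 0) 0 0 0

/-- The `3 × 3` block matrix `𝒜_S = [0 (J-R)Q B; ((J-R)Q)ᴴ QRQ 0; Bᴴ 0 S]`. -/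
def optA {𝕜 : Type*} [RCLike 𝕜] {n m : ℕ} (J R Q : Matrix (Fin n) (Fin n) 𝕜)
    (B : Matrix (Fin n) (Fin m) 𝕜) (S : Matrix (Fin m) (Fin m) 𝕜) :
    Matrix ((Fin n ⊕ Fin n) ⊕ Fin m) ((Fin n ⊕ Fin n) ⊕ Fin m) 𝕜 :=
  fromBlocks
    (fromBlocks 0 ((J - R) * Q) ((J - R) * Q)ᴴ (Q * R * Q))
    (fromRows B 0)
    (fromCols Bᴴ 0)
    S

/-- The pencil `sE - A`, as a matrix over the polynomial ring. -/
noncomputable def pencil {K N : Type*} [Field K] (E A : Matrix N N K) : Matrix N N K[X] :=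
  (X : K[X]) • E.map C - A.map C

/-- The pencil `sE - A` is regular: `det (sE - A)` is not the zero polynomial. -/
def IsRegularPencil {K N : Type*} [Field K] [Fintype N] [DecidableEq N]
    (E A : Matrix N N K) : Prop :=
  (pencil E A).det ≠ 0

/-- The nilpotent Jordan block of size `k` (ones on the superdiagonal). -/
def nilJordanBlock (K : Type*) [Field K] (k : ℕ) : Matrix (Fin k) (Fin k) K :=
  Matrix.of fun i j => if (i : ℕ) + 1 = (j : ℕ) then 1 else 0

/-- `sE - A` has Kronecker canonical form
`diag (s I_d - M, s N_{k₁} - I, …, s N_{k_b} - I)` up to strict equivalence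
`P (sE - A) T` with constant invertible `P`, `T`, where `N_k` is the nilpotent Jordan block of
size `k`. This is the Kronecker (Weierstrass) form of a regular pencil: the blocks
`s N_{kᵢ} - I` are those of the eigenvalue `∞`, and the finite part `s I_d - M` is given up to
similarity of `M`. The bijection `e` only enumerates rows and columns. -/
def HasKroneckerForm {K N : Type*} [Field K] [Fintype N] [DecidableEq N]
    (E A : Matrix N N K) {d b : ℕ} (M : Matrix (Fin d) (Fin d) K) (k : Fin b → ℕ) : Prop :=
  (∀ i, 0 < k i) ∧
  ∃ (e : N ≃ Fin d ⊕ (Σ i : Fin b, Fin (k i))) (P T : Matrix N N K),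
    IsUnit P ∧ IsUnit T ∧
    P * E * T = (fromBlocks 1 0 0 (blockDiagonal' fun i => nilJordanBlock K (k i))).submatrix e e ∧
    P * A * T = (fromBlocks M 0 0 1).submatrix e e

/-- The Kronecker index of the (regular) pencil `sE - A` is `ν`: the largest block of the
eigenvalue `∞` in the Kronecker canonical form has size `ν` (`ν = 0` if there is no such
block). -/
def HasKroneckerIndex {K N : Type*} [Field K] [Fintype N] [DecidableEq N]
    (E A : Matrix N N K) (ν : ℕ) : Prop :=
  ∃ (d b : ℕ) (M : Matrix (Fin d) (Fin d) K) (k : Fin b → ℕ),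
    HasKroneckerForm E A M k ∧ Finset.univ.sup k = ν

end OptimalityPencil

/-! The index is read off from chains at infinity: `E x₀ = 0`, `E xₗ₊₁ = A xₗ`, `x₀ ≠ 0`. Given a
Kronecker form, an infinite block of size at least `r` exists iff such a chain of length `r` does,
and a singular pencil has chains of every length. Here a chain starts at `(0, 0, u)`, and every `u ≠
0` reaches length three. Length four forces `Bᴴ QRQ B u = 0`, which by `R ≥ 0` means `RQBu = 0`;
conversely that suffices (`exists_isInfChain_four`). So the kernel conditions exclude length four,
which gives regularity and index at most three; `m ≥ 1` supplies length three. The Kronecker form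
itself comes from Fitting's decomposition and Jordan chains. -/

namespace OptimalityPencil

open Matrix Polynomial Module

/-! ### Jordan chains of a nilpotent endomorphism -/

/-- A basis of `K[X] ⧸ (X ^ k)` that multiplication by `X` shifts downwards. -/
theorem exists_shiftBasis_quotient_X_pow (K : Type*) [Field K] (k : ℕ) :
    ∃ b : Basis (Fin k) K (K[X] ⧸ K[X] ∙ (X : K[X]) ^ k),
      (∀ h : 0 < k, (X : K[X]) • b ⟨0, h⟩ = 0) ∧
      ∀ l (h : l + 1 < k), (X : K[X]) • b ⟨l + 1, h⟩ = b ⟨l, by omega⟩ := by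
  let p : K[X] := X ^ k
  have hp : p.Monic := monic_X_pow k
  let pb := AdjoinRoot.powerBasis' hp
  have hd : pb.dim = k := natDegree_X_pow k
  -- Powers in reverse order: index `0` is `X ^ (k - 1)`, which `X` kills.
  let b : Basis (Fin k) K (AdjoinRoot p) := pb.basis.reindex ((finCongr hd).trans Fin.revPerm)
  have hb : ∀ j : Fin k, b j = AdjoinRoot.mk p (X ^ (k - 1 - (j : ℕ))) := by
    intro j
    simp only [b, Basis.reindex_apply, pb.basis_eq_pow, map_pow]
    congr 1
    simp [Fin.rev]
    omega
  let b' : Basis (Fin k) K (K[X] ⧸ K[X] ∙ (X : K[X]) ^ k) := b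
  have hb' : ∀ j : Fin k, b' j = Submodule.Quotient.mk (X ^ (k - 1 - (j : ℕ))) := hb
  refine ⟨b', fun h => ?_, fun l h => ?_⟩
  · rw [hb', ← Submodule.Quotient.mk_smul, smul_eq_mul, ← pow_succ',
      show k - 1 - 0 + 1 = k by omega, Submodule.Quotient.mk_eq_zero]
    exact Submodule.mem_span_singleton_self _
  · rw [hb', hb', ← Submodule.Quotient.mk_smul, smul_eq_mul, ← pow_succ',
      show k - 1 - (l + 1) + 1 = k - 1 - l by omega]

theorem dfinsupp_basis_apply {ι R : Type*} [DecidableEq ι] [Semiring R] {M : ι → Type*}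
    [∀ i, AddCommMonoid (M i)] [∀ i, Module R (M i)] {η : ι → Type*}
    (b : ∀ i, Basis (η i) R (M i)) (i : ι) (j : η i) :
    DFinsupp.basis b ⟨i, j⟩ = DFinsupp.single i (b i j) := by
  classical
  apply (DFinsupp.basis b).repr.injective
  rw [Basis.repr_self]
  simp only [DFinsupp.basis, LinearEquiv.trans_apply, LinearEquiv.eq_symm_apply]
  simp [sigmaFinsuppEquivDFinsupp_single, DFinsupp.mapRange_single]

/-- A nilpotent endomorphism has a basis of Jordan chains. -/
theorem exists_jordanBasis_of_isNilpotent {K V : Type*} [Field K] [AddCommGroup V] [Module K V]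
    [FiniteDimensional K V] {f : End K V} (hf : IsNilpotent f) :
    ∃ (c : ℕ) (k : Fin c → ℕ) (b : Basis (Σ i, Fin (k i)) K V), (∀ i, 0 < k i) ∧
      (∀ i (h : 0 < k i), f (b ⟨i, 0, h⟩) = 0) ∧
      ∀ i l (h : l + 1 < k i), f (b ⟨i, l + 1, h⟩) = b ⟨i, l, by omega⟩ := by
  classical
  have htors : Module.IsTorsion' (AEval' f) (Submonoid.powers (X : K[X])) := by
    obtain ⟨r, hr⟩ := hf
    intro x
    refine ⟨⟨X ^ r, r, rfl⟩, ?_⟩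
    obtain ⟨v, rfl⟩ := (AEval'.of f).surjective x
    change (X ^ r : K[X]) • AEval'.of f v = 0
    rw [AEval'.X_pow_smul_of, hr]
    simp
  obtain ⟨d, k, ⟨φ⟩⟩ := Module.torsion_by_prime_power_decomposition (irreducible_X (R := K)) htors
  choose q hq₀ hq using fun i => exists_shiftBasis_quotient_X_pow K (k i)
  let ψ : V ≃ₗ[K] DirectSum (Fin d) fun i => K[X] ⧸ K[X] ∙ (X : K[X]) ^ k i :=
    (AEval'.of f).trans (φ.restrictScalars K)
  have hψ : ∀ v, ψ (f v) = (X : K[X]) • ψ v := fun v => by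
    change φ (AEval'.of f (f v)) = X • φ (AEval'.of f v)
    rw [← AEval'.X_smul_of, map_smul]
  let b₀ : Basis (Σ i, Fin (k i)) K (DirectSum (Fin d) fun i => K[X] ⧸ K[X] ∙ (X : K[X]) ^ k i) :=
    DFinsupp.basis q
  let b := b₀.map ψ.symm
  have hb : ∀ i j, ψ (b ⟨i, j⟩) = DirectSum.lof K[X] _ _ i (q i j) := by
    intro i j
    simp only [b, Basis.map_apply, LinearEquiv.apply_symm_apply]
    exact dfinsupp_basis_apply q i j
  have h₀ : ∀ i (h : 0 < k i), f (b ⟨i, 0, h⟩) = 0 := fun i h => by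
    apply ψ.injective
    rw [hψ, hb, ← map_smul, hq₀, map_zero, map_zero]
  have h₁ : ∀ i l (h : l + 1 < k i), f (b ⟨i, l + 1, h⟩) = b ⟨i, l, by omega⟩ := fun i l h => by
    apply ψ.injective
    rw [hψ, hb, hb, ← map_smul, hq]
  -- The structure theorem allows zero summands `k i = 0`; they are dropped.
  let e := (Fintype.equivFin {i // 0 < k i}).symm
  let σ : (Σ i, Fin (k (e i).1)) → Σ i, Fin (k i) := fun x => ⟨(e x.1).1, x.2⟩
  have hσ : Function.Bijective σ := by
    constructor
    · rintro ⟨i, j⟩ ⟨i', j'⟩ h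
      simp only [σ, Sigma.mk.injEq] at h
      obtain rfl : i = i' := e.injective (Subtype.ext h.1)
      simpa using h.2
    · rintro ⟨i, j⟩
      obtain ⟨i', hi⟩ := e.surjective ⟨i, j.pos⟩
      obtain rfl : (e i').1 = i := by rw [hi]
      exact ⟨⟨i', j⟩, rfl⟩
  refine ⟨_, fun i => k (e i).1, b.reindex (Equiv.ofBijective σ hσ).symm, fun i => (e i).2, ?_, ?_⟩
  · intro i h
    simpa [σ] using h₀ _ h
  · intro i l h
    simpa [σ] using h₁ _ l h

/-! ### Existence of the Kronecker form -/

/-- Weierstrass decomposition of a regular pencil `sE - A` of linear maps, in terms of bases. -/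
theorem exists_weierstrass_bases {K V W : Type*} [Field K] [AddCommGroup V] [Module K V]
    [FiniteDimensional K V] [AddCommGroup W] [Module K W] (E A : V →ₗ[K] W) (s : K)
    (hs : Function.Bijective (s • E - A)) :
    ∃ (d c : ℕ) (M : Matrix (Fin d) (Fin d) K) (k : Fin c → ℕ)
      (t : Basis (Fin d ⊕ Σ i, Fin (k i)) K V) (w : Basis (Fin d ⊕ Σ i, Fin (k i)) K W),
      (∀ i, 0 < k i) ∧ (∀ j, E (t (.inl j)) = w (.inl j)) ∧
      (∀ j, A (t (.inl j)) = ∑ i, M i j • w (.inl i)) ∧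
      (∀ x, A (t (.inr x)) = w (.inr x)) ∧
      (∀ i (h : 0 < k i), E (t (.inr ⟨i, 0, h⟩)) = 0) ∧
      ∀ i l (h : l + 1 < k i), E (t (.inr ⟨i, l + 1, h⟩)) = w (.inr ⟨i, l, by omega⟩) := by
  -- With `L = sE - A` and `G = L⁻¹E`, one has `E = LG` and `A = L(sG - 1)`, so only the
  -- endomorphism `G` has to be decomposed.
  let L : V ≃ₗ[K] W := LinearEquiv.ofBijective _ hs
  have hL : ∀ v, L v = s • E v - A v := fun v => rfl
  let G : End K V := L.symm.toLinearMap ∘ₗ E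
  have hE : ∀ v, E v = L (G v) := fun v => by simp [G]
  have hA : ∀ v, A v = L (s • G v - v) := fun v => by rw [map_sub, map_smul, ← hE, hL]; abel
  -- Fitting decomposition; `n ≥ 1` ensures `ker G ≤ ker (G ^ n)`.
  obtain ⟨n, hcompl, hn⟩ :=
    (G.eventually_isCompl_ker_pow_range_pow.and (Filter.eventually_ge_atTop 1)).exists
  set V₀ := LinearMap.ker (G ^ n) with hV₀
  set V₁ := LinearMap.range (G ^ n) with hV₁
  have hG₀ : ∀ v ∈ V₀, G v ∈ V₀ := fun v hv => by
    rw [hV₀, LinearMap.mem_ker] at hv ⊢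
    rw [← End.mul_apply, ← pow_succ, pow_succ', End.mul_apply, hv, map_zero]
  have hG₁ : ∀ v ∈ V₁, G v ∈ V₁ := by
    rintro _ ⟨v, rfl⟩
    exact ⟨G v, by rw [← End.mul_apply, ← End.mul_apply, ← pow_succ, pow_succ']⟩
  have hker : ∀ v, G v = 0 → v ∈ V₀ := fun v hv => by
    obtain ⟨r, rfl⟩ := Nat.exists_eq_add_of_le' hn
    rw [hV₀, LinearMap.mem_ker, pow_succ, End.mul_apply, hv, map_zero]
  have hdisj : ∀ v ∈ V₀, v ∈ V₁ → v = 0 := fun v h₀ h₁ =>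
    Submodule.disjoint_def.mp hcompl.disjoint v h₀ h₁
  let G₀ : End K V₀ := G.restrict hG₀
  let G₁ : End K V₁ := G.restrict hG₁
  have hnil : IsNilpotent G₀ := ⟨n, by
    ext v
    simp only [G₀]
    rw [Module.End.pow_restrict]
    simp⟩
  have hinj : Function.Injective G₁ := by
    rw [← LinearMap.ker_eq_bot, LinearMap.ker_eq_bot']
    intro v hv
    have hv' : G v = 0 := congrArg Subtype.val hv
    exact Subtype.ext (hdisj _ (hker _ hv') v.2)
  let g : V₁ ≃ₗ[K] V₁ := LinearEquiv.ofInjectiveEndo G₁ hinj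
  have hg : ∀ v, G (g.symm v : V₁) = v := fun v => congrArg Subtype.val (g.apply_symm_apply v)
  have hsnil : IsNilpotent (s • G₀) := hnil.smul s
  obtain ⟨u, hu⟩ := hsnil.isUnit_sub_one
  have hcomm : Commute (↑u⁻¹ : End K V₀) G₀ := by
    refine Commute.units_inv_left ?_
    rw [hu]
    exact ((Commute.refl G₀).smul_left s).sub_left (Commute.one_left _)
  -- On `V₀`, `u = sG₀ - 1` is invertible and `E = A ∘ f`: Jordan chains of `f` become the infinite
  -- blocks.
  let f : End K V₀ := ↑u⁻¹ * G₀
  have hf : IsNilpotent f := hcomm.isNilpotent_mul_left hnil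
  have huf : ∀ v : V₀, s • G (f v : V₀) - (f v : V₀) = G v := fun v => by
    have : (u : End K V₀) (f v) = G₀ v := by
      rw [← End.mul_apply, Units.mul_inv_cancel_left]
    rw [hu] at this
    exact congrArg Subtype.val this
  have huinj : ∀ v : V₀, s • G v - v = 0 → v = 0 := fun v hv => by
    have h : (u : End K V₀) v = 0 := by
      rw [hu]
      exact Subtype.ext hv
    have := congrArg (↑u⁻¹ : End K V₀) h
    rwa [← End.mul_apply, Units.inv_mul, map_zero] at this
  obtain ⟨c, k, b₀, hk, hb0, hb1⟩ := exists_jordanBasis_of_isNilpotent hf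
  let b₁ := finBasis K V₁
  let Ψ : V₁ × V₀ →ₗ[K] W := (E ∘ₗ V₁.subtype).coprod (A ∘ₗ V₀.subtype)
  have hΨ : ∀ x y, Ψ (x, y) = E x + A y := fun x y => rfl
  have hΨinj : Function.Injective Ψ := by
    rw [← LinearMap.ker_eq_bot, LinearMap.ker_eq_bot']
    rintro ⟨x, y⟩ hxy
    rw [hΨ, hE, hA, ← map_add, LinearEquiv.map_eq_zero_iff] at hxy
    have hy : s • G y - (y : V) ∈ V₀ := V₀.sub_mem (V₀.smul_mem _ (hG₀ _ y.2)) y.2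
    have hx := hG₁ _ x.2
    have hy0 : s • G y - (y : V) = 0 := hdisj _ hy (by
      rw [eq_neg_of_add_eq_zero_right hxy]
      exact V₁.neg_mem hx)
    rw [hy0, add_zero] at hxy
    have : x = 0 := Subtype.ext (hdisj _ (hker _ hxy) x.2)
    rw [this, huinj y hy0, Prod.mk_zero_zero]
  let Θ := Submodule.prodEquivOfIsCompl V₁ V₀ hcompl.symm
  have : FiniteDimensional K W := L.finiteDimensional
  let Ω : (V₁ × V₀) ≃ₗ[K] W :=
    Ψ.linearEquivOfInjective hΨinj (Θ.finrank_eq.trans L.finrank_eq)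
  have hΩ : ∀ x y, Ω (x, y) = E x + A y := fun x y => rfl
  -- On `V₁`, `A = L(sG - 1) = LG(s - G⁻¹) = E ∘ S`.
  let S : End K V₁ := s • 1 - g.symm.toLinearMap
  have hS : ∀ v : V₁, A v = E (S v : V₁) := fun v => by
    rw [hA, hE]
    simp [S, hg]
  have tl : ∀ j, ((b₁.prod b₀).map Θ) (.inl j) = b₁ j := fun j => by simp [Θ]
  have tr : ∀ j, ((b₁.prod b₀).map Θ) (.inr j) = b₀ j := fun j => by simp [Θ]
  have wl : ∀ j, ((b₁.prod b₀).map Ω) (.inl j) = E (b₁ j) := fun j => by simp [hΩ, Basis.prod_apply]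
  have wr : ∀ j, ((b₁.prod b₀).map Ω) (.inr j) = A (b₀ j) := fun j => by simp [hΩ, Basis.prod_apply]
  refine ⟨_, c, LinearMap.toMatrix b₁ b₁ S, k, (b₁.prod b₀).map Θ, (b₁.prod b₀).map Ω, hk, ?_, ?_,
    ?_, ?_, ?_⟩
  · intro j
    rw [tl, wl]
  · intro j
    simp only [tl, wl]
    have := congrArg (E ∘ₗ V₁.subtype) (b₁.sum_repr (S (b₁ j)))
    rw [map_sum] at this
    simp only [map_smul, LinearMap.comp_apply, Submodule.subtype_apply] at this
    rw [hS, ← this]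
    simp only [LinearMap.toMatrix_apply]
  · intro x
    rw [tr, wr]
  · intro i h
    rw [tr, hE, ← huf, hb0]
    simp
  · intro i l h
    rw [tr, wr, hE, ← huf, hb1, ← hA]

theorem hasKroneckerForm_of_bases {K N : Type*} [Field K] [Fintype N] [DecidableEq N]
    {E A : Matrix N N K} {d c : ℕ} {M : Matrix (Fin d) (Fin d) K} {k : Fin c → ℕ}
    (t w : Basis (Fin d ⊕ Σ i, Fin (k i)) K (N → K)) (hk : ∀ i, 0 < k i)
    (hEl : ∀ j, E *ᵥ t (.inl j) = w (.inl j))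
    (hAl : ∀ j, A *ᵥ t (.inl j) = ∑ i, M i j • w (.inl i))
    (hAr : ∀ x, A *ᵥ t (.inr x) = w (.inr x))
    (hEr₀ : ∀ i (h : 0 < k i), E *ᵥ t (.inr ⟨i, 0, h⟩) = 0)
    (hEr : ∀ i l (h : l + 1 < k i), E *ᵥ t (.inr ⟨i, l + 1, h⟩) = w (.inr ⟨i, l, by omega⟩)) :
    HasKroneckerForm E A M k := by
  let e : N ≃ Fin d ⊕ Σ i, Fin (k i) := (Pi.basisFun K N).indexEquiv t
  let t' := t.reindex e.symm
  let w' := w.reindex e.symm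
  have key : ∀ F : Matrix N N K, w'.toMatrix (Pi.basisFun K N) * F * (Pi.basisFun K N).toMatrix t'
      = (Matrix.of fun x y => w.repr (F *ᵥ t y) x).submatrix e e := by
    intro F
    have := basis_toMatrix_mul_linearMap_toMatrix_mul_basis_toMatrix t' (Pi.basisFun K N) w'
      (Pi.basisFun K N) (toLin' F)
    rw [LinearMap.toMatrix_eq_toMatrix', LinearMap.toMatrix'_toLin'] at this
    rw [this]
    ext x y
    simp [LinearMap.toMatrix_apply, t', w']
  refine ⟨hk, e, w'.toMatrix (Pi.basisFun K N), (Pi.basisFun K N).toMatrix t', ?_, ?_, ?_, ?_⟩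
  · exact IsUnit.of_mul_eq_one _ (w'.toMatrix_mul_toMatrix_flip _)
  · exact IsUnit.of_mul_eq_one _ (Basis.toMatrix_mul_toMatrix_flip _ t')
  · rw [key]
    congr 1
    ext x y
    rw [of_apply]
    rcases y with j | ⟨i, l, hl⟩
    · rw [hEl, Basis.repr_self]
      rcases x with x | x <;> simp [Finsupp.single_apply, Matrix.one_apply, eq_comm]
    · rcases l with _ | l
      · rw [hEr₀]
        rcases x with x | ⟨i', x⟩
        · simp
        · by_cases hi : i' = i
          · subst hi
            simp [nilJordanBlock]
          · simp [blockDiagonal'_apply_ne _ _ _ hi]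
      · rw [hEr, Basis.repr_self]
        rcases x with x | ⟨i', x⟩
        · simp
        · by_cases hi : i' = i
          · subst hi
            simp [nilJordanBlock, Finsupp.single_apply, Fin.ext_iff, eq_comm]
          · simp [blockDiagonal'_apply_ne _ _ _ hi, Ne.symm hi]
  · rw [key]
    congr 1
    ext x y
    rw [of_apply]
    rcases y with j | y
    · rw [hAl]
      rcases x with x | x <;> simp [Finsupp.single_apply]
    · rw [hAr, Basis.repr_self]
      rcases x with x | x <;> simp [Finsupp.single_apply, Matrix.one_apply, eq_comm]

/-- Existence of the Kronecker canonical form of a pencil with `sE - A` invertible for some `s`. -/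
theorem exists_hasKroneckerForm {K N : Type*} [Field K] [Fintype N] [DecidableEq N]
    {E A : Matrix N N K} {s : K} (hs : IsUnit (s • E - A)) :
    ∃ (d b : ℕ) (M : Matrix (Fin d) (Fin d) K) (k : Fin b → ℕ), HasKroneckerForm E A M k := by
  have hbij : Function.Bijective (s • toLin' E - toLin' A) := by
    rw [← map_smul, ← map_sub]
    exact ⟨mulVec_injective_iff_isUnit.mpr hs, mulVec_surjective_iff_isUnit.mpr hs⟩
  obtain ⟨d, c, M, k, t, w, hk, h₁, h₂, h₃, h₄, h₅⟩ := exists_weierstrass_bases _ _ s hbij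
  exact ⟨d, c, M, k, hasKroneckerForm_of_bases t w hk h₁ h₂ h₃ h₄ h₅⟩

/-- Over an infinite field a nonzero determinant polynomial has a non-root. -/
theorem IsRegularPencil.exists_isUnit {K N : Type*} [Field K] [Infinite K] [Fintype N]
    [DecidableEq N] {E A : Matrix N N K} (h : IsRegularPencil E A) :
    ∃ s : K, IsUnit (s • E - A) := by
  by_contra! hs
  refine h (Polynomial.funext fun s => ?_)
  have hdet : (s • E - A).det = 0 := by
    simpa [isUnit_iff_isUnit_det] using hs s
  rw [eval_zero, ← hdet, ← coe_evalRingHom, RingHom.map_det]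
  congr 1
  ext i j
  simp [pencil, mul_comm s]

/-! ### Chains at infinity and block sizes -/

/-- `x 0, …, x (r - 1)` is a chain of the pencil `sE - A` at the eigenvalue `∞`. -/
def IsInfChain {K N : Type*} [Field K] [Fintype N] (E A : Matrix N N K) (r : ℕ)
    (x : ℕ → N → K) : Prop :=
  E *ᵥ x 0 = 0 ∧ ∀ l, l + 1 < r → E *ᵥ x (l + 1) = A *ᵥ x l

section

variable {K N : Type*} [Field K] [Fintype N] {E A : Matrix N N K}

theorem isInfChain_submatrix_iff {N' : Type*} [Fintype N'] (e : N' ≃ N) {r : ℕ}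
    {z : ℕ → N → K} :
    IsInfChain (E.submatrix e e) (A.submatrix e e) r (fun l => z l ∘ e) ↔ IsInfChain E A r z := by
  have hinj : Function.Injective fun v : N → K => v ∘ e := e.surjective.injective_comp_right
  simp only [IsInfChain, submatrix_mulVec_equiv, Function.comp_assoc, e.self_comp_symm,
    Function.comp_id]
  refine and_congr ?_ (forall₂_congr fun l _ => hinj.eq_iff)
  exact hinj.eq_iff (b := 0)

theorem blockDiagonal_nilJordanBlock_mulVec {b : ℕ} (k : Fin b → ℕ) (v : (Σ i, Fin (k i)) → K)
    (i : Fin b) (j : Fin (k i)) :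
    ((blockDiagonal' fun i => nilJordanBlock K (k i)) *ᵥ v) ⟨i, j⟩ =
      if h : (j : ℕ) + 1 < k i then v ⟨i, j + 1, h⟩ else 0 := by
  simp only [mulVec, dotProduct, Fintype.sum_sigma]
  rw [Finset.sum_eq_single i]
  · simp only [blockDiagonal'_apply_eq, nilJordanBlock, of_apply, ite_mul, one_mul, zero_mul]
    split_ifs with h
    · rw [Finset.sum_eq_single ⟨j + 1, h⟩]
      · simp
      · intro x _ hx
        rw [if_neg fun h' => hx (Fin.ext h'.symm)]
      · simp
    · exact Finset.sum_eq_zero fun x _ => if_neg fun h' => h (by have := x.2; omega)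
  · intro i' _ hi
    simp [blockDiagonal'_apply_ne _ _ _ (Ne.symm hi)]
  · simp

variable [DecidableEq N]

theorem isInfChain_mul_iff {P T : Matrix N N K} (hP : IsUnit P) {r : ℕ} {y : ℕ → N → K} :
    IsInfChain (P * E * T) (P * A * T) r y ↔ IsInfChain E A r fun l => T *ᵥ y l := by
  have hinj := mulVec_injective_of_isUnit hP
  simp only [IsInfChain, Matrix.mul_assoc, ← mulVec_mulVec]
  refine and_congr ?_ (forall₂_congr fun l _ => hinj.eq_iff)
  exact hinj.eq_iff' (mulVec_zero P)

/-- A chain of length `r` at `∞` with nonzero head forces an infinite block of size at least `r`. -/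
theorem HasKroneckerForm.exists_le_of_isInfChain {d b : ℕ} {M : Matrix (Fin d) (Fin d) K}
    {k : Fin b → ℕ} (hK : HasKroneckerForm E A M k) {r : ℕ} {x : ℕ → N → K}
    (hx : IsInfChain E A r x) (hx0 : x 0 ≠ 0) : ∃ i, r ≤ k i := by
  obtain ⟨-, e, P, T, hP, hT, hE, hA⟩ := hK
  obtain ⟨T, rfl⟩ := hT
  let z : ℕ → (Fin d ⊕ Σ i, Fin (k i)) → K := fun l => ((↑T⁻¹ : Matrix N N K) *ᵥ x l) ∘ e.symm
  have hzx : ∀ l, (T : Matrix N N K) *ᵥ (z l ∘ e) = x l := fun l => by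
    simp [z, Function.comp_assoc]
  obtain ⟨hz0, hz⟩ : IsInfChain (fromBlocks 1 0 0 (blockDiagonal' fun i => nilJordanBlock K (k i)))
      (fromBlocks M 0 0 1) r z := by
    rw [← isInfChain_submatrix_iff e, ← hE, ← hA, isInfChain_mul_iff hP]
    simpa only [hzx] using hx
  simp only [fromBlocks_mulVec, one_mulVec, zero_mulVec, add_zero, zero_add] at hz0 hz
  have hl : ∀ j, z 0 (.inl j) = 0 := fun j => congrFun hz0 (.inl j)
  obtain ⟨⟨i, j⟩, hij⟩ : ∃ a, z 0 (.inr a) ≠ 0 := by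
    by_contra! h
    refine hx0 ?_
    have : z 0 = 0 := by
      ext (j | a)
      exacts [hl j, h a]
    rw [← hzx, this]
    simp
  -- On the infinite part `A` is the identity and `E` a shift, so a nonzero coordinate moves up one
  -- place per step inside its block.
  have step : ∀ l, l < r → ∃ h : j + l < k i, z l (.inr ⟨i, j + l, h⟩) ≠ 0 := by
    intro l
    induction l with
    | zero => exact fun _ => ⟨j.2, hij⟩
    | succ l ih =>
      intro hlr
      obtain ⟨h, hne⟩ := ih (by omega)
      have := congrFun (hz l hlr) (.inr ⟨i, j + l, h⟩)
      simp only [Sum.elim_inr, blockDiagonal_nilJordanBlock_mulVec, Function.comp_apply] at this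
      rw [← this] at hne
      split_ifs at hne with h'
      · exact ⟨h', hne⟩
      · exact absurd rfl hne
  refine ⟨i, ?_⟩
  rcases r with _ | r
  · exact Nat.zero_le _
  · obtain ⟨h, -⟩ := step r (by omega)
    omega

/-- An infinite block of size at least `r` gives a chain of length `r` at `∞` with nonzero head. -/
theorem HasKroneckerForm.exists_isInfChain {d b : ℕ} {M : Matrix (Fin d) (Fin d) K}
    {k : Fin b → ℕ} (hK : HasKroneckerForm E A M k) {r : ℕ} {i : Fin b} (hr : r ≤ k i) :
    ∃ x, IsInfChain E A r x ∧ x 0 ≠ 0 := by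
  obtain ⟨hk, e, P, T, hP, hT, hE, hA⟩ := hK
  let z : ℕ → (Fin d ⊕ Σ i, Fin (k i)) → K := fun l =>
    Sum.elim 0 fun a => if a.1 = i ∧ (a.2 : ℕ) = l then 1 else 0
  refine ⟨fun l => T *ᵥ (z l ∘ e), ?_, ?_⟩
  · rw [← isInfChain_mul_iff hP, hE, hA, isInfChain_submatrix_iff]
    simp only [IsInfChain, fromBlocks_mulVec, one_mulVec, zero_mulVec, add_zero, zero_add]
    constructor
    · ext (j | ⟨i', j⟩)
      · simp [z]
      · simp [z, blockDiagonal_nilJordanBlock_mulVec]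
    · intro l hl
      ext (j | ⟨i', j⟩)
      · simp only [z, Sum.elim_inl, Sum.elim_comp_inl, mulVec_zero]
      · simp only [z, Sum.elim_inr, blockDiagonal_nilJordanBlock_mulVec, Function.comp_apply,
          Nat.add_right_cancel_iff]
        split_ifs with h₁ h₂ h₃
        · rfl
        · rfl
        · obtain ⟨rfl, h⟩ := h₃
          omega
        · rfl
  · intro h
    have h0 : z 0 ∘ e = 0 := mulVec_injective_of_isUnit hT (by simpa using h)
    have := congrFun h0 (e.symm (.inr ⟨i, 0, hk i⟩))
    simp [z] at this

/-- A singular pencil has chains at `∞` of every length with nonzero head. -/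
theorem exists_isInfChain_of_not_isRegularPencil (h : ¬ IsRegularPencil E A) (r : ℕ) :
    ∃ x, IsInfChain E A r x ∧ x 0 ≠ 0 := by
  rw [IsRegularPencil, not_not, ← exists_mulVec_eq_zero_iff] at h
  obtain ⟨v, hv0, hv⟩ := h
  -- The coefficients of a polynomial kernel vector, read from the top degree down and padded with
  -- zeros, form the chain.
  let c : ℕ → N → K := fun l i => (v i).coeff l
  have hEc : ∀ l i, (((E.map C : Matrix N N K[X]) *ᵥ v) i).coeff l = (E *ᵥ c l) i := fun l i => by
    simp [mulVec, dotProduct, c]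
  have hAc : ∀ l i, (((A.map C : Matrix N N K[X]) *ᵥ v) i).coeff l = (A *ᵥ c l) i := fun l i => by
    simp [mulVec, dotProduct, c]
  have hv' : ∀ i, X * ((E.map C : Matrix N N K[X]) *ᵥ v) i = ((A.map C : Matrix N N K[X]) *ᵥ v) i :=
    fun i => by
      have := congrFun hv i
      rw [pencil, sub_mulVec, smul_mulVec] at this
      simpa [sub_eq_zero] using this
  have hc0 : A *ᵥ c 0 = 0 := by
    ext i
    rw [← hAc, ← hv']
    simp
  have hc : ∀ l, E *ᵥ c l = A *ᵥ c (l + 1) := fun l => by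
    ext i
    rw [← hAc, ← hv', coeff_X_mul, hEc]
  let D := Finset.univ.sup fun i => (v i).natDegree
  have hD : ∀ l, D < l → c l = 0 := fun l hl => by
    ext i
    exact coeff_eq_zero_of_natDegree_lt
      ((Finset.le_sup (f := fun i => (v i).natDegree) (Finset.mem_univ i)).trans_lt hl)
  have htop : c D ≠ 0 := by
    obtain ⟨i₀, hi₀⟩ := Function.ne_iff.mp hv0
    obtain ⟨i, -, hi⟩ := Finset.exists_mem_eq_sup Finset.univ ⟨i₀, Finset.mem_univ _⟩
      fun i => (v i).natDegree
    intro h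
    have hDi : D = (v i).natDegree := hi
    have hvi : v i = 0 := by
      rw [← leadingCoeff_eq_zero, leadingCoeff, ← hDi]
      exact congrFun h i
    -- The maximum may be attained at a zero entry, as `natDegree 0 = 0`; then `v i₀` is a nonzero
    -- constant.
    have hD0 : D = 0 := by rw [hDi, hvi, natDegree_zero]
    have hi₀D : (v i₀).natDegree = D := by
      have : (v i₀).natDegree ≤ D :=
        Finset.le_sup (f := fun i => (v i).natDegree) (Finset.mem_univ i₀)
      omega
    refine hi₀ (leadingCoeff_eq_zero.mp ?_)
    rw [leadingCoeff, hi₀D]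
    exact congrFun h i₀
  refine ⟨fun l => if l ≤ D then c (D - l) else 0, ⟨?_, fun l _ => ?_⟩, by simpa using htop⟩
  · simp [hc, hD (D + 1)]
  · rcases lt_trichotomy l D with h | rfl | h
    · simp only [if_pos h.le, if_pos (Nat.succ_le_of_lt h), hc]
      congr 2
      omega
    · simp [hc0]
    · simp [Nat.not_le.mpr h, show ¬ l + 1 ≤ D by omega]

end

/-! ### Chains of the pencil `sℰ - 𝒜₀` -/

/-- The block vector with components `a`, `b`, `c`. -/
def blockVec {K : Type*} {n m : ℕ} (a b : Fin n → K) (c : Fin m → K) :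
    (Fin n ⊕ Fin n) ⊕ Fin m → K :=
  Sum.elim (Sum.elim a b) c

theorem blockVec_inj {K : Type*} {n m : ℕ} {a b a' b' : Fin n → K} {c c' : Fin m → K} :
    blockVec a b c = blockVec a' b' c' ↔ (a = a' ∧ b = b') ∧ c = c' := by
  simp only [blockVec, Sum.elim_eq_iff]

theorem exists_eq_blockVec {K : Type*} {n m : ℕ} (x : (Fin n ⊕ Fin n) ⊕ Fin m → K) :
    ∃ a b c, x = blockVec a b c :=
  ⟨_, _, _, by rw [blockVec, Sum.elim_comp_inl_inr, Sum.elim_comp_inl_inr]⟩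

theorem blockVec_zero {K : Type*} [Zero K] {n m : ℕ} :
    blockVec 0 0 0 = (0 : (Fin n ⊕ Fin n) ⊕ Fin m → K) := by
  ext ((i | i) | i) <;> rfl

theorem blockVec_head_ne_zero {K : Type*} [Zero K] {n m : ℕ} {u : Fin m → K} (hu : u ≠ 0) :
    blockVec 0 0 u ≠ (0 : (Fin n ⊕ Fin n) ⊕ Fin m → K) :=
  fun h => hu (funext fun i => congrFun h (.inr i))

section

variable {𝕜 : Type*} [RCLike 𝕜] {n m : ℕ} {J R Q : Matrix (Fin n) (Fin n) 𝕜}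
  {B : Matrix (Fin n) (Fin m) 𝕜}

theorem optE_mulVec (a b : Fin n → 𝕜) (c : Fin m → 𝕜) :
    optE 𝕜 n m *ᵥ blockVec a b c = blockVec b (-a) 0 := by
  simp [optE, blockVec, fromBlocks_mulVec, neg_mulVec]

theorem optA_mulVec (a b : Fin n → 𝕜) (c : Fin m → 𝕜) :
    optA J R Q B 0 *ᵥ blockVec a b c =
      blockVec (((J - R) * Q) *ᵥ b + B *ᵥ c) (((J - R) * Q)ᴴ *ᵥ a + (Q * R * Q) *ᵥ b)
        (Bᴴ *ᵥ a) := by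
  simp only [optA, blockVec, fromBlocks_mulVec, fromRows_mulVec, fromCols_mulVec, Sum.elim_comp_inl,
    Sum.elim_comp_inr, zero_mulVec, add_zero, zero_add]
  ext ((i | i) | i) <;> simp

/-- If `im B ∩ ker RQ = 0` and `ker B = 0`, every chain of length four at `∞` has zero head. -/
theorem head_eq_zero_of_isInfChain (hR : R.PosSemidef) (hQ : Q.PosSemidef)
    (h : LinearMap.range B.mulVecLin ⊓ LinearMap.ker (R * Q).mulVecLin = ⊥)
    (hB : LinearMap.ker B.mulVecLin = ⊥) {x : ℕ → (Fin n ⊕ Fin n) ⊕ Fin m → 𝕜}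
    (hx : IsInfChain (optE 𝕜 n m) (optA J R Q B 0) 4 x) : x 0 = 0 := by
  obtain ⟨h0, hstep⟩ := hx
  obtain ⟨a₀, b₀, u, hx₀⟩ := exists_eq_blockVec (x 0)
  obtain ⟨a₁, b₁, c₁, hx₁⟩ := exists_eq_blockVec (x 1)
  obtain ⟨a₂, b₂, c₂, hx₂⟩ := exists_eq_blockVec (x 2)
  obtain ⟨a₃, b₃, c₃, hx₃⟩ := exists_eq_blockVec (x 3)
  have h1 := hstep 0 (by norm_num)
  have h2 := hstep 1 (by norm_num)
  have h3 := hstep 2 (by norm_num)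
  simp only [Nat.reduceAdd] at h1 h2 h3
  rw [hx₀, optE_mulVec, ← blockVec_zero, blockVec_inj] at h0
  rw [hx₀, hx₁, optE_mulVec, optA_mulVec, blockVec_inj] at h1
  rw [hx₁, hx₂, optE_mulVec, optA_mulVec, blockVec_inj] at h2
  rw [hx₂, hx₃, optE_mulVec, optA_mulVec, blockVec_inj] at h3
  obtain ⟨⟨rfl, ha₀⟩, -⟩ := h0
  obtain rfl : a₀ = 0 := neg_eq_zero.mp ha₀
  obtain ⟨⟨rfl, ha₁⟩, -⟩ := h1
  obtain rfl : a₁ = 0 := by simpa using ha₁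
  have ha₂ : a₂ = -((Q * R * Q) *ᵥ B *ᵥ u) := by
    rw [← neg_eq_iff_eq_neg, h2.1.2]
    simp
  -- The last block row of the third step reads `Bᴴ a₂ = 0`.
  have hBW : Bᴴ *ᵥ ((Q * R * Q) *ᵥ B *ᵥ u) = 0 := by
    have := h3.2.symm
    rw [ha₂, mulVec_neg] at this
    exact neg_eq_zero.mp this
  have hRQ : R *ᵥ (Q *ᵥ (B *ᵥ u)) = 0 := by
    rw [← hR.dotProduct_mulVec_zero_iff]
    calc star (Q *ᵥ B *ᵥ u) ⬝ᵥ R *ᵥ Q *ᵥ B *ᵥ u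
        = star u ⬝ᵥ (Bᴴ *ᵥ ((Q * R * Q) *ᵥ B *ᵥ u)) := by
          rw [star_mulVec, star_mulVec, hQ.1.eq, ← dotProduct_mulVec, ← dotProduct_mulVec]
          simp only [mulVec_mulVec, Matrix.mul_assoc]
      _ = 0 := by rw [hBW, dotProduct_zero]
  have hBu : B *ᵥ u = 0 := by
    have : B *ᵥ u ∈ LinearMap.range B.mulVecLin ⊓ LinearMap.ker (R * Q).mulVecLin :=
      ⟨⟨u, rfl⟩, by simpa [← mulVec_mulVec] using hRQ⟩
    rwa [h, Submodule.mem_bot] at this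
  have hu : u = 0 := LinearMap.ker_eq_bot'.mp hB u hBu
  rw [hx₀, hu, blockVec_zero]

/-- Every `u` is the head of a chain of length three at `∞`. -/
theorem exists_isInfChain_three (u : Fin m → 𝕜) :
    ∃ x, IsInfChain (optE 𝕜 n m) (optA J R Q B 0) 3 x ∧ x 0 = blockVec 0 0 u := by
  refine ⟨fun l => match l with
    | 0 => blockVec 0 0 u
    | 1 => blockVec 0 (B *ᵥ u) 0
    | _ => blockVec (-((Q * R * Q) *ᵥ B *ᵥ u)) (((J - R) * Q) *ᵥ B *ᵥ u) 0, ⟨?_, ?_⟩, rfl⟩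
  · simp [optE_mulVec, blockVec_zero]
  · intro l hl
    obtain rfl | rfl : l = 0 ∨ l = 1 := by omega
    all_goals simp [optE_mulVec, optA_mulVec]

/-- If `RQBu = 0`, then `u` is the head of a chain of length four at `∞`. -/
theorem exists_isInfChain_four {u : Fin m → 𝕜} (hu : (R * Q) *ᵥ B *ᵥ u = 0) :
    ∃ x, IsInfChain (optE 𝕜 n m) (optA J R Q B 0) 4 x ∧ x 0 = blockVec 0 0 u := by
  have hW : (Q * R * Q) *ᵥ B *ᵥ u = 0 := by
    rw [Matrix.mul_assoc, ← mulVec_mulVec, hu, mulVec_zero]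
  -- Since `QRQBu = 0`, `a₂` may vanish, so `Bᴴ a₂ = 0` no longer obstructs the step to `x 3`.
  refine ⟨fun l => match l with
    | 0 => blockVec 0 0 u
    | 1 => blockVec 0 (B *ᵥ u) 0
    | 2 => blockVec 0 (((J - R) * Q) *ᵥ B *ᵥ u) 0
    | _ => blockVec (-((Q * R * Q) *ᵥ ((J - R) * Q) *ᵥ B *ᵥ u))
        (((J - R) * Q) *ᵥ ((J - R) * Q) *ᵥ B *ᵥ u) 0, ⟨?_, ?_⟩, rfl⟩
  · simp [optE_mulVec, blockVec_zero]
  · intro l hl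
    obtain rfl | rfl | rfl : l = 0 ∨ l = 1 ∨ l = 2 := by omega
    · simp [optE_mulVec, optA_mulVec]
    · simp only [optE_mulVec, optA_mulVec, hW]
      simp
    · simp only [optE_mulVec, optA_mulVec]
      simp

/-- If `Bu = 0`, then `(0, 0, u)` lies in the kernels of both `ℰ` and `𝒜₀`. -/
theorem ker_mulVecLin_eq_bot_of_isRegularPencil
    (h : IsRegularPencil (optE 𝕜 n m) (optA J R Q B 0)) : LinearMap.ker B.mulVecLin = ⊥ := by
  obtain ⟨s, hs⟩ := h.exists_isUnit
  rw [LinearMap.ker_eq_bot']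
  intro u hu
  rw [mulVecLin_apply] at hu
  by_contra hu0
  refine blockVec_head_ne_zero (n := n) hu0 (mulVec_injective_of_isUnit hs ?_)
  simp [sub_mulVec, smul_mulVec, optE_mulVec, optA_mulVec, hu, blockVec_zero]

end

end OptimalityPencil

/-! ### The equivalence -/

open OptimalityPencil

theorem mainTheorem5 {𝕜 : Type*} [RCLike 𝕜] {n m : ℕ} (hm : 0 < m)
    (J R Q : Matrix (Fin n) (Fin n) 𝕜) (B : Matrix (Fin n) (Fin m) 𝕜)
    (hJRQB : OptimalityPencil.IsPortHamiltonian J R Q B) :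
    (LinearMap.range B.mulVecLin ⊓ LinearMap.ker (R * Q).mulVecLin = ⊥ ∧
        LinearMap.ker B.mulVecLin = ⊥) ↔
      (OptimalityPencil.IsRegularPencil (OptimalityPencil.optE 𝕜 n m)
          (OptimalityPencil.optA J R Q B 0) ∧
        OptimalityPencil.HasKroneckerIndex (OptimalityPencil.optE 𝕜 n m)
          (OptimalityPencil.optA J R Q B 0) 3) := by
  constructor
  · rintro ⟨h, hB⟩
    have hno : ¬ ∃ x, IsInfChain (optE 𝕜 n m) (optA J R Q B 0) 4 x ∧ x 0 ≠ 0 :=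
      fun ⟨x, hx, hx0⟩ => hx0
        (head_eq_zero_of_isInfChain hJRQB.posSemidef_R hJRQB.posSemidef_Q h hB hx)
    have hreg : IsRegularPencil (optE 𝕜 n m) (optA J R Q B 0) := by
      by_contra hreg
      exact hno (exists_isInfChain_of_not_isRegularPencil hreg 4)
    obtain ⟨s, hs⟩ := hreg.exists_isUnit
    obtain ⟨d, b, M, k, hK⟩ := exists_hasKroneckerForm hs
    refine ⟨hreg, d, b, M, k, hK, le_antisymm (Finset.sup_le fun i _ => ?_) ?_⟩
    · by_contra! hi
      exact hno (hK.exists_isInfChain (i := i) hi)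
    · obtain ⟨x, hx, hx0⟩ := exists_isInfChain_three (J := J) (R := R) (Q := Q) (B := B)
        (Pi.single ⟨0, hm⟩ 1)
      obtain ⟨i, hi⟩ := hK.exists_le_of_isInfChain hx
        (hx0 ▸ blockVec_head_ne_zero (by simp))
      exact hi.trans (Finset.le_sup (Finset.mem_univ i))
  · rintro ⟨hreg, d, b, M, k, hK, hsup⟩
    refine ⟨?_, ker_mulVecLin_eq_bot_of_isRegularPencil hreg⟩
    rw [eq_bot_iff]
    rintro _ ⟨⟨u, rfl⟩, hu⟩
    rw [Submodule.mem_bot]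
    by_contra hne
    obtain ⟨x, hx, hx0⟩ := exists_isInfChain_four (J := J) (u := u) hu
    have hu0 : u ≠ 0 := fun h0 => hne (by rw [h0, map_zero])
    obtain ⟨i, hi⟩ := hK.exists_le_of_isInfChain hx (hx0 ▸ blockVec_head_ne_zero hu0)
    have := Finset.le_sup (f := k) (Finset.mem_univ i)
    omega
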